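/- Let $A\in\mathbb R^{n\times n}$ be nonsingular, $B\in\mathbb R^{n\times m}$ with $(A,B)$ controllable, $Q\ge 0$ and $R>0$ symmetric real matrices with $(Q^{1/2},A)$ observable. A gain $K\in\mathbb R^{m\times n}$ is called stabilizing if $I+BK$ is invertible and $(I+BK)^{-1}A$ is Hurwitz, i.e. if the derivative feedback $u=-K\dot x$ stabilizes $\dot x=Ax+Bu$. Let $x$ be a solution of $\dot x=Ax+Bu$ on $[0,NT]$, $T>0$, for some square-integrable input $u$, and let $\bar x=x+x_{\rm b}$ be the state measured with an unknown constant bias $x_{\rm b}\in\mathbb R^n$. Let $\Delta_{\kappa}$, $\Delta_x$, $I_{xx}$, $I_{xu}$ be the matrices whose $j$-th rows, $j=1,\dots,N$, are $$\big[\bar x\otimes\bar x\big]_{(j-1)T}^{jT}{}^{\rm T},\qquad \big[\bar x\big]_{(j-1)T}^{jT}{}^{\rm T},\qquad \int_{(j-1)T}^{jT}\dot x^{\rm T}\otimes\dot x^{\rm T}\,d\tau,\qquad \int_{(j-1)T}^{jT}\dot x^{\rm T}\otimes u^{\rm T}\,d\tau,$$ let $D_n$ be the duplication matrix ($\operatorname{vec}(P)=D_n\operatorname{vech}(P)$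 for symmetric $P\in\mathbb R^{n\times n}$, where $\operatorname{vech}(P)$ lists the $n(n+1)/2$ independent entries), and for a gain $K$ put $$X(K)=\big[\Delta_{\kappa}D_n,\ \Delta_x,\ -2I_{xx}(I_n\otimes K^{\rm T}R)-2I_{xu}(I_n\otimes R)\big],\qquad Y(K)=-I_{xx}\operatorname{vec}(Q+K^{\rm T}RK).$$ Define a symmetric matrix $\hat P(K)$, a vector $\hat\epsilon(K)$ and a gain $\hat K^{+}(K)$ by $$\begin{bmatrix}\operatorname{vech}(\hat P)\\ \hat\epsilon\\ \operatorname{vec}(\hat K^{+})\end{bmatrix}=\big(X(K)^{\rm T}X(K)\big)^{-1}X(K)^{\rm T}Y(K).$$ (a) If $X(K)$ has full column rank, then $P=\hat P(K)$ and $K'=\hat K^{+}(K)$ are the unique solution, with $P$ symmetric, of the model-based policy-iteration equations $$P F+F^{\rm T}P+Q+K^{\rm T}RK=0,\quad F=A^{-1}(I+BK),\qquad K'=-R^{-1}B^{\rm T}(A^{-1})^{\rm T}P,$$ and $\hat\epsilon(K)=-2\hat P(K)x_{\rm b}$. If moreover $K$ is stabilizing, then $\hat P(K)$ is positive definite. (b)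 Let $K_1$ be stabilizing and set $\hat K_1=K_1$, $\hat P_i=\hat P(\hat K_i)$, $\hat K_{i+1}=\hat K^{+}(\hat K_i)$ for $i\ge1$. If $X_i=X(\hat K_i)$ has full column rank for every $i\ge 1$, then every $\hat K_i$ is stabilizing, the algebraic Riccati equation $$P A^{-1}+(A^{-1})^{\rm T}P-PA^{-1}BR^{-1}B^{\rm T}(A^{-1})^{\rm T}P+Q=0$$ has exactly one positive definite solution $P^*$, and, as $i\to\infty$, $\hat P_i\to P^*$ and $\hat K_i\to K^*=-R^{-1}B^{\rm T}(A^{-1})^{\rm T}P^*$. -/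

import Mathlib

open Matrix MeasureTheory Filter Topology
open scoped Kronecker

noncomputable section

namespace DFC

/-! ### Linear systems -/

/-- Kalman controllability of `(A, B)`: the matrix `[B, AB, …, A^(n-1) B]` has rank `n`. -/
def Controllable {n m : ℕ} (A : Matrix (Fin n) (Fin n) ℝ) (B : Matrix (Fin n) (Fin m) ℝ) : Prop :=
  (Matrix.of fun (a : Fin n) (q : Fin n × Fin m) => (A ^ (q.1 : ℕ) * B) a q.2).rank = n

/-- Kalman observability of `(C, A)`: the matrix with row blocks `C, CA, …, C A^(n-1)` has
rank `n`. -/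
def Observable {n l : ℕ} (C : Matrix (Fin l) (Fin n) ℝ) (A : Matrix (Fin n) (Fin n) ℝ) : Prop :=
  (Matrix.of fun (q : Fin n × Fin l) (a : Fin n) => (C * A ^ (q.1 : ℕ)) q.2 a).rank = n

section Sqrt

open scoped MatrixOrder

/-- The positive semidefinite square root `Q^{1/2}` of a positive semidefinite matrix. -/
def psdSqrt {n : ℕ} (Q : Matrix (Fin n) (Fin n) ℝ) : Matrix (Fin n) (Fin n) ℝ := CFC.sqrt Q

end Sqrt

/-- All complex eigenvalues have negative real part. -/
def Hurwitz {n : ℕ} (M : Matrix (Fin n) (Fin n) ℝ) : Prop :=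
  ∀ z ∈ spectrum ℂ (M.map (fun r : ℝ => (r : ℂ))), z.re < 0

/-- The derivative feedback `u = -K ẋ` stabilizes `ẋ = A x + B u`: the closed loop
`(I + B K) ẋ = A x` can be solved for `ẋ`, and `(I + B K)⁻¹ A` is Hurwitz. -/
def Stabilizing {n m : ℕ} (A : Matrix (Fin n) (Fin n) ℝ) (B : Matrix (Fin n) (Fin m) ℝ)
    (K : Matrix (Fin m) (Fin n) ℝ) : Prop :=
  IsUnit (1 + B * K).det ∧ Hurwitz ((1 + B * K)⁻¹ * A)

/-- `x` is a (Carathéodory) solution of `ẋ = A x + B u` on `[0, τ]` for a square integrable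
input `u`. Classical solutions with continuous or piecewise continuous `u` are included. -/
structure IsTrajectory {n m : ℕ} (A : Matrix (Fin n) (Fin n) ℝ) (B : Matrix (Fin n) (Fin m) ℝ)
    (τ : ℝ) (x : ℝ → Fin n → ℝ) (u : ℝ → Fin m → ℝ) : Prop where
  input_memLp : MemLp u 2 (volume.restrict (Set.Icc 0 τ))
  absCont : AbsolutelyContinuousOnInterval x 0 τ
  hasDerivAt : ∀ᵐ t ∂volume.restrict (Set.Icc 0 τ), HasDerivAt x (A *ᵥ x t + B *ᵥ u t) t

/-! ### The Riccati equation and model-based policy iteration -/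

/-- `P A⁻¹ + A⁻ᵀ P - P A⁻¹ B R⁻¹ Bᵀ A⁻ᵀ P + Q = 0`. -/
def SolvesARE {n m : ℕ} (A : Matrix (Fin n) (Fin n) ℝ) (B : Matrix (Fin n) (Fin m) ℝ)
    (Q : Matrix (Fin n) (Fin n) ℝ) (R : Matrix (Fin m) (Fin m) ℝ)
    (P : Matrix (Fin n) (Fin n) ℝ) : Prop :=
  P * A⁻¹ + A⁻¹ᵀ * P - P * A⁻¹ * B * R⁻¹ * Bᵀ * A⁻¹ᵀ * P + Q = 0

/-- Policy evaluation of the gain `K`: `P F + Fᵀ P + Q + Kᵀ R K = 0` with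
`F = A⁻¹ (I + B K)`. -/
def SolvesEvaluation {n m : ℕ} (A : Matrix (Fin n) (Fin n) ℝ) (B : Matrix (Fin n) (Fin m) ℝ)
    (Q : Matrix (Fin n) (Fin n) ℝ) (R : Matrix (Fin m) (Fin m) ℝ)
    (K : Matrix (Fin m) (Fin n) ℝ) (P : Matrix (Fin n) (Fin n) ℝ) : Prop :=
  P * (A⁻¹ * (1 + B * K)) + (A⁻¹ * (1 + B * K))ᵀ * P + Q + Kᵀ * R * K = 0

/-- The gain `-R⁻¹ Bᵀ A⁻ᵀ P` belonging to `P`. -/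
def gainOf {n m : ℕ} (A : Matrix (Fin n) (Fin n) ℝ) (B : Matrix (Fin n) (Fin m) ℝ)
    (R : Matrix (Fin m) (Fin m) ℝ) (P : Matrix (Fin n) (Fin n) ℝ) : Matrix (Fin m) (Fin n) ℝ :=
  -(R⁻¹ * Bᵀ * A⁻¹ᵀ * P)

/-! ### Data-driven policy iteration -/

/-- The signals available to the data-driven method: `N` windows of length `T`, the state
derivative `dx`, the biased state `xbar` and the input `u`. -/
structure Data (n m : ℕ) where
  N : ℕ
  T : ℝ
  dx : ℝ → Fin n → ℝ
  xbar : ℝ → Fin n → ℝ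
  u : ℝ → Fin m → ℝ

/-- The data recorded along a state trajectory `x` with input `u` when the state measurement has
the constant bias `xb`. -/
def measure {n m : ℕ} (N : ℕ) (T : ℝ) (x : ℝ → Fin n → ℝ) (u : ℝ → Fin m → ℝ)
    (xb : Fin n → ℝ) : Data n m where
  N := N
  T := T
  dx := deriv x
  xbar := fun t => x t + xb
  u := u

namespace Data

variable {n m : ℕ} (d : Data n m)

/-- Row `j` is `∫ ẋᵀ ⊗ ẋᵀ` over the window `[jT, (j+1)T]`. -/
def Ixx : Matrix (Fin d.N) (Fin n × Fin n) ℝ :=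
  Matrix.of fun j q => ∫ t in (j * d.T)..((j + 1) * d.T), d.dx t q.1 * d.dx t q.2

/-- Row `j` is `∫ ẋᵀ ⊗ uᵀ` over the window `[jT, (j+1)T]`. -/
def Ixu : Matrix (Fin d.N) (Fin n × Fin m) ℝ :=
  Matrix.of fun j q => ∫ t in (j * d.T)..((j + 1) * d.T), d.dx t q.1 * d.u t q.2

/-- The quadratic basis `x̄ ⊗ x̄`. -/
def xkappa (t : ℝ) : Fin n × Fin n → ℝ := fun q => d.xbar t q.1 * d.xbar t q.2

/-- Row `j` is the increment of `x̄ ⊗ x̄` over the window `[jT, (j+1)T]`. -/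
def deltaKappa : Matrix (Fin d.N) (Fin n × Fin n) ℝ :=
  Matrix.of fun j q => d.xkappa ((j + 1) * d.T) q - d.xkappa (j * d.T) q

/-- Row `j` is the increment of `x̄` over the window `[jT, (j+1)T]`. -/
def deltaX : Matrix (Fin d.N) (Fin n) ℝ :=
  Matrix.of fun j a => d.xbar ((j + 1) * d.T) a - d.xbar (j * d.T) a

end Data

/-- The duplication matrix: it sends the `n (n + 1) / 2` independent entries of a symmetric matrix,
indexed by unordered pairs, to the full vector of its entries. -/
def duplication (n : ℕ) : Matrix (Fin n × Fin n) (Sym2 (Fin n)) ℝ :=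
  Matrix.of fun q s => if s(q.1, q.2) = s then 1 else 0

/-- The unknowns: the independent entries of the symmetric matrix `P`, the vector `ε` and the
entries of the next gain; `n (n + 1) / 2 + n + n m` in number. -/
abbrev Unknown (n m : ℕ) : Type := Sym2 (Fin n) ⊕ (Fin n ⊕ (Fin n × Fin m))

namespace Data

variable {n m : ℕ} (d : Data n m)

/-- The data matrix of the gain `K`. The matrix of increments of `x̄ ⊗ x̄` is multiplied by the
duplication matrix, since `x̄ ⊗ x̄` lists every mixed monomial twice. -/
def dataMatrix (R : Matrix (Fin m) (Fin m) ℝ) (K : Matrix (Fin m) (Fin n) ℝ) :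
    Matrix (Fin d.N) (Unknown n m) ℝ :=
  Matrix.fromCols (d.deltaKappa * duplication n)
    (Matrix.fromCols d.deltaX
      (-(2 : ℝ) • (d.Ixx * ((1 : Matrix (Fin n) (Fin n) ℝ) ⊗ₖ (Kᵀ * R)))
        - (2 : ℝ) • (d.Ixu * ((1 : Matrix (Fin n) (Fin n) ℝ) ⊗ₖ R))))

/-- The right-hand side `-I_xx vec(Q + Kᵀ R K)`. -/
def rhs (Q : Matrix (Fin n) (Fin n) ℝ) (R : Matrix (Fin m) (Fin m) ℝ)
    (K : Matrix (Fin m) (Fin n) ℝ) : Fin d.N → ℝ :=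
  -(d.Ixx *ᵥ Matrix.vec (Q + Kᵀ * R * K))

/-- The data matrix of the gain `K` has full column rank. -/
def FullColumnRank (R : Matrix (Fin m) (Fin m) ℝ) (K : Matrix (Fin m) (Fin n) ℝ) : Prop :=
  (d.dataMatrix R K).rank = Fintype.card (Unknown n m)

/-- The least-squares solution `(XᵀX)⁻¹ Xᵀ Y`. -/
def leastSquares (Q : Matrix (Fin n) (Fin n) ℝ) (R : Matrix (Fin m) (Fin m) ℝ)
    (K : Matrix (Fin m) (Fin n) ℝ) : Unknown n m → ℝ :=
  (((d.dataMatrix R K)ᵀ * d.dataMatrix R K)⁻¹ * (d.dataMatrix R K)ᵀ) *ᵥ d.rhs Q R K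

/-- The symmetric matrix read off from the least-squares solution. -/
def Phat (Q : Matrix (Fin n) (Fin n) ℝ) (R : Matrix (Fin m) (Fin m) ℝ)
    (K : Matrix (Fin m) (Fin n) ℝ) : Matrix (Fin n) (Fin n) ℝ :=
  Matrix.of fun a b => d.leastSquares Q R K (Sum.inl s(a, b))

/-- The bias parameter read off from the least-squares solution. -/
def epsHat (Q : Matrix (Fin n) (Fin n) ℝ) (R : Matrix (Fin m) (Fin m) ℝ)
    (K : Matrix (Fin m) (Fin n) ℝ) : Fin n → ℝ :=
  fun a => d.leastSquares Q R K (Sum.inr (Sum.inl a))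

/-- The next gain read off from the least-squares solution (its entries are stacked
column by column). -/
def Khat (Q : Matrix (Fin n) (Fin n) ℝ) (R : Matrix (Fin m) (Fin m) ℝ)
    (K : Matrix (Fin m) (Fin n) ℝ) : Matrix (Fin m) (Fin n) ℝ :=
  Matrix.of fun c a => d.leastSquares Q R K (Sum.inr (Sum.inr (a, c)))

/-- The data-driven gains, started at `K₁`; `gainSeq i` is the gain with number `i + 1`. -/
def gainSeq (Q : Matrix (Fin n) (Fin n) ℝ) (R : Matrix (Fin m) (Fin m) ℝ)
    (K₁ : Matrix (Fin m) (Fin n) ℝ) : ℕ → Matrix (Fin m) (Fin n) ℝ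
  | 0 => K₁
  | i + 1 => d.Khat Q R (gainSeq Q R K₁ i)

/-- The data-driven value matrices; `valueSeq i` is the value matrix with number `i + 1`. -/
def valueSeq (Q : Matrix (Fin n) (Fin n) ℝ) (R : Matrix (Fin m) (Fin m) ℝ)
    (K₁ : Matrix (Fin m) (Fin n) ℝ) (i : ℕ) : Matrix (Fin n) (Fin n) ℝ :=
  d.Phat Q R (d.gainSeq Q R K₁ i)

end Data

end DFC

end

/-! The value `xᵀ P x` changes over a window by integrals of `ẋ ⊗ ẋ` and `ẋ ⊗ u` once `x` is
eliminated through `x = A⁻¹ (ẋ - B u)`; measuring with a bias `x_b` adds only the linear term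
`2 x_bᵀ P x` and a constant. Hence every symmetric solution `P` of the evaluation equation of `K`,
together with `ε = -2 P x_b` and the improved gain, solves the linear system `X(K) θ = Y(K)`
exactly. Full column rank then makes least squares return it, and also makes the Lyapunov operator
of the closed loop injective on symmetric matrices, so that a solution exists.

For a Hurwitz closed loop the Cayley transform turns the Lyapunov equation into a Stein equation,
which gives `P ≥ 0`; observability upgrades this to `P > 0` and, conversely, makes the improved
loop Hurwitz. Completing the square shows that the values decrease. Their limit solves the Riccati
equation, and the comparison of a Riccati solution with the value of any Hurwitz gain gives
uniqueness. -/

namespace DFC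

section Spectral

theorem tendsto_pow_of_spectralRadius_lt_one {𝔸 : Type*} [NormedRing 𝔸] [NormedAlgebra ℂ 𝔸]
    [CompleteSpace 𝔸] {a : 𝔸} (h : spectralRadius ℂ a < 1) :
    Tendsto (fun k => a ^ k) atTop (𝓝 0) := by
  obtain ⟨r, har, hr⟩ := ENNReal.lt_iff_exists_nnreal_btwn.1 h
  have hr1 : (r : ℝ) < 1 := by exact_mod_cast hr
  refine squeeze_zero_norm' ?_ (tendsto_pow_atTop_nhds_zero_of_lt_one r.coe_nonneg hr1)
  have gelfand := spectrum.pow_nnnorm_pow_one_div_tendsto_nhds_spectralRadius a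
  filter_upwards [gelfand.eventually_lt_const har, eventually_ne_atTop 0] with k hk hk0
  rw [one_div, ENNReal.rpow_inv_lt_iff (by positivity), ENNReal.rpow_natCast] at hk
  exact_mod_cast hk.le

theorem div_mem_spectrum_of_mem_spectrum_cayley {𝕜 𝔸 : Type*} [Field 𝕜] [NeZero (2 : 𝕜)] [Ring 𝔸]
    [Algebra 𝕜 𝔸] {a : 𝔸} {b : 𝔸ˣ} (hb : (b : 𝔸) = 1 - a) {μ : 𝕜}
    (hμ : μ ∈ spectrum 𝕜 ((1 + a) * ↑b⁻¹)) : (μ - 1) / (μ + 1) ∈ spectrum 𝕜 a := by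
  have factor : algebraMap 𝕜 𝔸 μ - (1 + a) * ↑b⁻¹ =
      (algebraMap 𝕜 𝔸 (μ - 1) - algebraMap 𝕜 𝔸 (μ + 1) * a) * ↑b⁻¹ := by
    rw [Units.eq_mul_inv_iff_mul_eq, sub_mul, Units.inv_mul_cancel_right, hb, map_sub, map_add,
      map_one]
    noncomm_ring
  rw [spectrum.mem_iff, factor, Units.isUnit_mul_units] at hμ
  have hμ1 : μ + 1 ≠ 0 := fun h0 => hμ <| by
    have : μ - 1 ≠ 0 := fun h1 => two_ne_zero (α := 𝕜) (by linear_combination h0 - h1)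
    simpa only [h0, map_zero, zero_mul, sub_zero] using (this.isUnit).map (algebraMap 𝕜 𝔸)
  refine fun hu => hμ ?_
  have : algebraMap 𝕜 𝔸 (μ - 1) - algebraMap 𝕜 𝔸 (μ + 1) * a =
      algebraMap 𝕜 𝔸 (μ + 1) * (algebraMap 𝕜 𝔸 ((μ - 1) / (μ + 1)) - a) := by
    rw [mul_sub, ← map_mul, mul_div_cancel₀ _ hμ1]
  rw [this]
  exact (hμ1.isUnit.map (algebraMap 𝕜 𝔸)).mul hu

theorem norm_lt_one_of_re_cayley_neg {μ : ℂ} (h : ((μ - 1) / (μ + 1)).re < 0) : ‖μ‖ < 1 := by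
  have hμ : μ + 1 ≠ 0 := by
    rintro h0
    simp [h0] at h
  rw [Complex.div_re, ← add_div, div_lt_iff₀ (Complex.normSq_pos.2 hμ), zero_mul] at h
  simp only [Complex.sub_re, Complex.add_re, Complex.sub_im, Complex.add_im, Complex.one_re,
    Complex.one_im, sub_zero, add_zero] at h
  rw [← sq_lt_one_iff₀ (norm_nonneg μ), ← Complex.normSq_eq_norm_sq, Complex.normSq_apply]
  linarith

section ComplexPowers

attribute [local instance] Matrix.linftyOpNormedRing Matrix.linftyOpNormedAlgebra

theorem tendsto_matrix_pow_of_spectrum {ι : Type*} [Fintype ι] [DecidableEq ι]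
    {M : Matrix ι ι ℂ} (h : ∀ z ∈ spectrum ℂ M, ‖z‖ < 1) :
    Tendsto (fun k => M ^ k) atTop (𝓝 0) := by
  cases isEmpty_or_nonempty ι
  · exact tendsto_const_nhds.congr fun _ => Subsingleton.elim _ _
  · exact tendsto_pow_of_spectralRadius_lt_one
      (spectrum.spectralRadius_lt_of_forall_lt M fun z hz => h z hz)

end ComplexPowers

/-- The complexification of a real square matrix, as a ring homomorphism, so that the spectrum in
the definition of `Hurwitz` can be computed with. -/
abbrev complexify {ι : Type*} [Fintype ι] [DecidableEq ι] : Matrix ι ι ℝ →+* Matrix ι ι ℂ :=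
  Complex.ofRealHom.mapMatrix

theorem isUnit_complexify_iff {ι : Type*} [Fintype ι] [DecidableEq ι] {M : Matrix ι ι ℝ} :
    IsUnit (complexify M) ↔ IsUnit M := by
  rw [isUnit_iff_isUnit_det, isUnit_iff_isUnit_det, ← RingHom.map_det, isUnit_map_iff]

theorem tendsto_pow_of_complexify {ι : Type*} [Fintype ι] [DecidableEq ι] {M : Matrix ι ι ℝ}
    (h : Tendsto (fun k => complexify M ^ k) atTop (𝓝 0)) :
    Tendsto (fun k => M ^ k) atTop (𝓝 0) := by
  have hre : Continuous fun C : Matrix ι ι ℂ => C.map Complex.re := by fun_prop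
  have hlim := (hre.tendsto 0).comp h
  rw [Matrix.map_zero _ Complex.zero_re] at hlim
  refine hlim.congr fun k => ?_
  rw [Function.comp_apply, ← map_pow]
  rfl

variable {n : ℕ} {F : Matrix (Fin n) (Fin n) ℝ}

theorem Hurwitz.isUnit (hF : Hurwitz F) : IsUnit F := by
  rw [← isUnit_complexify_iff, ← spectrum.zero_notMem_iff ℂ]
  exact fun h0 => (hF 0 h0).false

theorem Hurwitz.isUnit_one_sub (hF : Hurwitz F) : IsUnit (1 - F) := by
  have h1 : (1 : ℂ) ∉ spectrum ℂ (complexify F) := fun h => zero_lt_one.not_gt (hF 1 h)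
  rwa [spectrum.notMem_iff, map_one, ← map_one complexify, ← map_sub,
    isUnit_complexify_iff] at h1

theorem Hurwitz.inv (hF : Hurwitz F) : Hurwitz F⁻¹ := by
  obtain ⟨u, rfl⟩ := hF.isUnit
  intro z hz
  rw [← coe_units_inv] at hz
  have hre := hF z⁻¹ (spectrum.inv₀_mem_iff (a := u.map complexify.toMonoidHom).2 hz)
  rw [Complex.inv_re] at hre
  by_contra! hz0
  exact hre.not_ge (div_nonneg hz0 (Complex.normSq_nonneg z))

theorem Hurwitz.tendsto_cayley_pow (hF : Hurwitz F) :
    Tendsto (fun k => ((1 + F) * (1 - F)⁻¹) ^ k) atTop (𝓝 0) := by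
  obtain ⟨b, hb⟩ := hF.isUnit_one_sub
  refine tendsto_pow_of_complexify (tendsto_matrix_pow_of_spectrum fun μ hμ => ?_)
  have hb' : (Units.map complexify.toMonoidHom b : Matrix (Fin n) (Fin n) ℂ) =
      1 - complexify F := by
    rw [← map_one complexify, ← map_sub, ← hb]
    rfl
  rw [← hb, ← coe_units_inv, map_mul, map_add, map_one] at hμ
  exact norm_lt_one_of_re_cayley_neg (hF _ (div_mem_spectrum_of_mem_spectrum_cayley hb' hμ))

theorem exists_mulVec_eq_of_mem_spectrum {z : ℂ} (hz : z ∈ spectrum ℂ (complexify F)) :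
    ∃ a b : Fin n → ℝ, (a ≠ 0 ∨ b ≠ 0) ∧ F *ᵥ a = z.re • a - z.im • b ∧
      F *ᵥ b = z.im • a + z.re • b := by
  rw [← Matrix.spectrum_toLin', ← Module.End.hasEigenvalue_iff_mem_spectrum] at hz
  obtain ⟨v, hv⟩ := hz.exists_hasEigenvector
  have hFv : complexify F *ᵥ v = z • v := hv.apply_eq_smul
  refine ⟨fun i => (v i).re, fun i => (v i).im, ?_, funext fun i => ?_, funext fun i => ?_⟩
  · by_contra! h0
    exact hv.2 (funext fun i => Complex.ext (congrFun h0.1 i) (congrFun h0.2 i))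
  · simpa [mulVec, dotProduct] using congrArg Complex.re (congrFun hFv i)
  · simpa [mulVec, dotProduct, add_comm] using congrArg Complex.im (congrFun hFv i)

end Spectral

section RealForms

variable {ι κ : Type*} [Fintype ι] [Fintype κ]

theorem dotProduct_mulVec_nonneg {P : Matrix ι ι ℝ} (hP : P.PosSemidef) (v : ι → ℝ) :
    0 ≤ v ⬝ᵥ P *ᵥ v :=
  hP.dotProduct_mulVec_nonneg v

theorem mulVec_eq_zero_of_dotProduct_nonpos {P : Matrix ι ι ℝ} (hP : P.PosSemidef) {v : ι → ℝ}
    (hv : v ⬝ᵥ P *ᵥ v ≤ 0) : P *ᵥ v = 0 :=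
  (hP.dotProduct_mulVec_zero_iff v).1 (hv.antisymm (dotProduct_mulVec_nonneg hP v))

theorem dotProduct_mulVec_comm {P : Matrix ι ι ℝ} (hP : P.IsSymm) (v w : ι → ℝ) :
    v ⬝ᵥ P *ᵥ w = w ⬝ᵥ P *ᵥ v := by
  rw [← dotProduct_transpose_mulVec, hP.eq]

theorem dotProduct_transpose_mul_mul_mulVec (S : Matrix κ κ ℝ) (M : Matrix κ ι ℝ) (v : ι → ℝ) :
    v ⬝ᵥ (Mᵀ * S * M) *ᵥ v = (M *ᵥ v) ⬝ᵥ S *ᵥ (M *ᵥ v) := by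
  rw [← mulVec_mulVec, ← mulVec_mulVec, dotProduct_transpose_mulVec, dotProduct_comm]

omit [Fintype ι] in
theorem posSemidef_transpose_mul_mul [Finite ι] {S : Matrix κ κ ℝ} (hS : S.PosSemidef)
    (M : Matrix κ ι ℝ) : (Mᵀ * S * M).PosSemidef :=
  hS.conjTranspose_mul_mul_same M

omit [Fintype ι] in
theorem isClosed_posSemidef [Finite ι] : IsClosed {P : Matrix ι ι ℝ | P.PosSemidef} := by
  have := Fintype.ofFinite ι
  simp only [posSemidef_iff_dotProduct_mulVec, isHermitian_iff_isSymm, IsSymm, star_trivial,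
    Set.ofPred_and, Set.ofPred_forall]
  exact (isClosed_eq continuous_id.matrix_transpose continuous_id).inter
    (isClosed_iInter fun v => isClosed_le continuous_const (by fun_prop))

end RealForms

section Lyapunov

variable {ι κ μ : Type*} [Fintype ι]

theorem posSemidef_of_stein [DecidableEq ι] {G P : Matrix ι ι ℝ}
    (hG : Tendsto (fun k => G ^ k) atTop (𝓝 0)) (h : (P - Gᵀ * P * G).PosSemidef) :
    P.PosSemidef := by
  have hpow : ∀ k, (P - (G ^ k)ᵀ * P * G ^ k).PosSemidef := by
    intro k
    induction k with
    | zero => simpa using PosSemidef.zero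
    | succ k ih =>
      have telescope : P - (G ^ (k + 1))ᵀ * P * G ^ (k + 1) =
          (P - Gᵀ * P * G) + Gᵀ * (P - (G ^ k)ᵀ * P * G ^ k) * G := by
        rw [pow_succ, transpose_mul]
        noncomm_ring
      rw [telescope]
      exact h.add (posSemidef_transpose_mul_mul ih G)
  have hcont : Continuous fun M : Matrix ι ι ℝ => P - Mᵀ * P * M := by fun_prop
  have hlim := (hcont.tendsto 0).comp hG
  rw [Matrix.mul_zero, sub_zero] at hlim
  exact isClosed_posSemidef.mem_of_tendsto hlim (Eventually.of_forall hpow)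

/-- The Lyapunov operator `P ↦ P F + Fᵀ P` of `F`, the left-hand side of the policy evaluation
equation. -/
def lyapunovMap (F : Matrix ι ι ℝ) : Matrix ι ι ℝ →ₗ[ℝ] Matrix ι ι ℝ :=
  LinearMap.mulRight ℝ F + LinearMap.mulLeft ℝ Fᵀ

theorem lyapunovMap_apply (F P : Matrix ι ι ℝ) : lyapunovMap F P = P * F + Fᵀ * P := rfl

theorem isSymm_lyapunovMap (F : Matrix ι ι ℝ) {P : Matrix ι ι ℝ} (hP : P.IsSymm) :
    (lyapunovMap F P).IsSymm := by
  rw [IsSymm, lyapunovMap_apply, transpose_add, transpose_mul, transpose_mul, transpose_transpose,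
    hP.eq, add_comm]

theorem dotProduct_lyapunovMap_mulVec (F : Matrix ι ι ℝ) {P : Matrix ι ι ℝ} (hP : P.IsSymm)
    (v : ι → ℝ) : v ⬝ᵥ lyapunovMap F P *ᵥ v = 2 * (v ⬝ᵥ P *ᵥ (F *ᵥ v)) := by
  rw [lyapunovMap_apply, add_mulVec, dotProduct_add, ← mulVec_mulVec, ← mulVec_mulVec,
    dotProduct_transpose_mulVec, dotProduct_comm (P *ᵥ v), dotProduct_mulVec_comm hP (F *ᵥ v),
    two_mul]

theorem stein_cayley [DecidableEq ι] {F N : Matrix ι ι ℝ} (hN : (1 - F) * N = 1)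
    (P : Matrix ι ι ℝ) :
    P - ((1 + F) * N)ᵀ * P * ((1 + F) * N) = Nᵀ * -((2 : ℝ) • lyapunovMap F P) * N := by
  have hNt : Nᵀ * (1 - F)ᵀ = 1 := by rw [← transpose_mul, hN, transpose_one]
  calc P - ((1 + F) * N)ᵀ * P * ((1 + F) * N)
      = (Nᵀ * (1 - F)ᵀ) * P * ((1 - F) * N) - ((1 + F) * N)ᵀ * P * ((1 + F) * N) := by
        rw [hN, hNt, Matrix.one_mul, Matrix.mul_one]
    _ = Nᵀ * ((1 - F)ᵀ * P * (1 - F) - (1 + F)ᵀ * P * (1 + F)) * N := by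
        rw [transpose_mul]
        noncomm_ring
    _ = Nᵀ * -((2 : ℝ) • lyapunovMap F P) * N := by
        congr 2
        rw [lyapunovMap_apply, two_smul, transpose_add, transpose_sub, transpose_one]
        noncomm_ring

/-- Observability of `(C, F)` in its coordinate-free form: no nonzero `F`-invariant subspace is
annihilated by `C`. Unlike the Kalman rank condition it passes directly to `F⁻¹` and to feedback
loops. -/
def GeometricallyObservable (C : Matrix κ ι ℝ) (F : Matrix ι ι ℝ) : Prop :=
  ∀ V : Submodule ℝ (ι → ℝ), (∀ v ∈ V, F *ᵥ v ∈ V) → (∀ v ∈ V, C *ᵥ v = 0) → V = ⊥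

namespace GeometricallyObservable

theorem of_ker_le {C : Matrix κ ι ℝ} {D : Matrix μ ι ℝ} {F : Matrix ι ι ℝ}
    (h : GeometricallyObservable C F) (hCD : ∀ v, D *ᵥ v = 0 → C *ᵥ v = 0) :
    GeometricallyObservable D F :=
  fun V hF hD => h V hF fun v hv => hCD v (hD v hv)

theorem inv [DecidableEq ι] {C : Matrix κ ι ℝ} {A : Matrix ι ι ℝ}
    (h : GeometricallyObservable C A) (hA : IsUnit A.det) : GeometricallyObservable C A⁻¹ := by
  refine fun V hV hC => h V (fun v hv => ?_) hC
  let f : V →ₗ[ℝ] V := A⁻¹.mulVecLin.restrict hV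
  have hf : Function.Injective f := fun a b hab => Subtype.ext <|
    mulVec_injective_of_isUnit ((isUnit_iff_isUnit_det _).2 (A.isUnit_nonsing_inv_det hA))
      (congrArg Subtype.val hab)
  obtain ⟨w, hw⟩ := LinearMap.injective_iff_surjective.1 hf ⟨v, hv⟩
  have hwv : A⁻¹ *ᵥ (w : ι → ℝ) = v := congrArg Subtype.val hw
  rw [← hwv, mulVec_mulVec, Matrix.mul_nonsing_inv _ hA, one_mulVec]
  exact w.2

theorem feedback [Fintype κ] [DecidableEq ι] {Q G : Matrix ι ι ℝ} (h : GeometricallyObservable Q G)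
    {R : Matrix κ κ ℝ} {S : Matrix ι ι ℝ} (hQ : Q.PosSemidef) (hR : R.PosDef)
    (hS : S.PosSemidef) (B : Matrix ι κ ℝ) (K : Matrix κ ι ℝ) :
    GeometricallyObservable (Q + Kᵀ * R * K + S) (G * (1 + B * K)) := by
  have hker : ∀ v, (Q + Kᵀ * R * K + S) *ᵥ v = 0 → Q *ᵥ v = 0 ∧ K *ᵥ v = 0 := by
    intro v hv
    have hsum := congrArg (v ⬝ᵥ ·) hv
    simp only [add_mulVec, dotProduct_add, dotProduct_transpose_mul_mul_mulVec,
      dotProduct_zero] at hsum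
    have hQv := dotProduct_mulVec_nonneg hQ v
    have hRv := dotProduct_mulVec_nonneg hR.posSemidef (K *ᵥ v)
    have hSv := dotProduct_mulVec_nonneg hS v
    refine ⟨mulVec_eq_zero_of_dotProduct_nonpos hQ (by linarith), ?_⟩
    by_contra hKv
    have := hR.dotProduct_mulVec_pos hKv
    rw [star_trivial] at this
    linarith
  refine fun V hV hC => h V (fun v hv => ?_) fun v hv => (hker v (hC v hv)).1
  have := hV v hv
  rwa [← mulVec_mulVec, add_mulVec, one_mulVec, ← mulVec_mulVec, (hker v (hC v hv)).2,
    mulVec_zero, add_zero] at this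

variable {F P W : Matrix ι ι ℝ}

theorem posDef_of_lyapunov (hobs : GeometricallyObservable W F)
    (hP : P.PosSemidef) (hW : W.PosSemidef) (h : lyapunovMap F P + W = 0) : P.PosDef := by
  have hker : ∀ v, P *ᵥ v = 0 → W *ᵥ v = 0 := by
    intro v hv
    have hform := congrArg (fun M => v ⬝ᵥ M *ᵥ v) h
    simp only [add_mulVec, dotProduct_add, zero_mulVec, dotProduct_zero] at hform
    rw [dotProduct_lyapunovMap_mulVec F (isHermitian_iff_isSymm.1 hP.1),
      dotProduct_mulVec_comm (isHermitian_iff_isSymm.1 hP.1), hv, dotProduct_zero, mul_zero,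
      zero_add] at hform
    exact mulVec_eq_zero_of_dotProduct_nonpos hW hform.le
  have hbot := hobs (LinearMap.ker P.mulVecLin) (fun v hv => ?_) hker
  · classical
    exact hP.posDef_iff_isUnit.2
      (mulVec_injective_iff_isUnit.1 (LinearMap.ker_eq_bot.1 hbot))
  · have hPv : P *ᵥ v = 0 := hv
    have hv0 := congrArg (· *ᵥ v) h
    simp only [lyapunovMap_apply, add_mulVec, ← mulVec_mulVec, hPv, hker v hPv, mulVec_zero,
      add_zero, zero_mulVec] at hv0
    exact hv0

end GeometricallyObservable

variable {n : ℕ} {F P W : Matrix (Fin n) (Fin n) ℝ}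

theorem Hurwitz.posSemidef_of_lyapunov (hF : Hurwitz F) (hW : W.PosSemidef)
    (h : lyapunovMap F P + W = 0) : P.PosSemidef := by
  have hN : (1 - F) * (1 - F)⁻¹ = 1 :=
    mul_nonsing_inv _ ((isUnit_iff_isUnit_det _).1 hF.isUnit_one_sub)
  refine posSemidef_of_stein hF.tendsto_cayley_pow ?_
  rw [stein_cayley hN, eq_neg_of_add_eq_zero_left h, smul_neg, neg_neg]
  exact posSemidef_transpose_mul_mul (hW.smul zero_le_two) _

theorem GeometricallyObservable.hurwitz_of_lyapunov (hobs : GeometricallyObservable W F)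
    (hP : P.PosDef) (hW : W.PosSemidef) (h : lyapunovMap F P + W = 0) : Hurwitz F := by
  intro z hz
  obtain ⟨a, b, hab, ha, hb⟩ := exists_mulVec_eq_of_mem_spectrum hz
  by_contra! hre
  have hPs : P.IsSymm := isHermitian_iff_isSymm.1 hP.1
  have hform : ∀ v, 2 * (v ⬝ᵥ P *ᵥ (F *ᵥ v)) + v ⬝ᵥ W *ᵥ v = 0 := fun v => by
    rw [← dotProduct_lyapunovMap_mulVec F hPs, ← dotProduct_add, ← add_mulVec, h, zero_mulVec,
      dotProduct_zero]
  have hsum : 2 * (z.re * (a ⬝ᵥ P *ᵥ a + b ⬝ᵥ P *ᵥ b)) + a ⬝ᵥ W *ᵥ a + b ⬝ᵥ W *ᵥ b = 0 := by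
    have hfa := hform a
    have hfb := hform b
    simp only [ha, hb, mulVec_add, mulVec_sub, mulVec_smul, dotProduct_add, dotProduct_sub,
      dotProduct_smul, smul_eq_mul, dotProduct_mulVec_comm hPs b a] at hfa hfb
    linear_combination hfa + hfb
  have hPab := mul_nonneg hre (add_nonneg (dotProduct_mulVec_nonneg hP.posSemidef a)
    (dotProduct_mulVec_nonneg hP.posSemidef b))
  have hWa := dotProduct_mulVec_nonneg hW a
  have hWb := dotProduct_mulVec_nonneg hW b
  have hWa0 : W *ᵥ a = 0 := mulVec_eq_zero_of_dotProduct_nonpos hW (by linarith)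
  have hWb0 : W *ᵥ b = 0 := mulVec_eq_zero_of_dotProduct_nonpos hW (by linarith)
  have hbot : Submodule.span ℝ {a, b} = ⊥ := by
    refine hobs _ (fun v hv => ?_) fun v hv => ?_ <;>
      obtain ⟨s, t, rfl⟩ := Submodule.mem_span_pair.1 hv
    · rw [mulVec_add, mulVec_smul, mulVec_smul, ha, hb]
      exact Submodule.mem_span_pair.2
        ⟨s * z.re + t * z.im, t * z.re - s * z.im, by module⟩
    · rw [mulVec_add, mulVec_smul, mulVec_smul, hWa0, hWb0, smul_zero, smul_zero, add_zero]
  rw [Submodule.span_eq_bot] at hbot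
  exact hab.elim (· (hbot a (by simp))) (· (hbot b (by simp)))

end Lyapunov

section Observability

theorem mulVec_injective_of_rank_eq_card {ι κ : Type*} [Fintype κ]
    {M : Matrix ι κ ℝ} (h : M.rank = Fintype.card κ) : Function.Injective M.mulVec := by
  have hrn := M.mulVecLin.finrank_range_add_finrank_ker
  rw [Module.finrank_fintype_fun_eq_card, ← h, Matrix.rank] at hrn
  have hker : Module.finrank ℝ (LinearMap.ker M.mulVecLin) = 0 := by omega
  exact LinearMap.ker_eq_bot.1 (Submodule.finrank_eq_zero.1 hker)

variable {n : ℕ}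

theorem Observable.geometricallyObservable {l : ℕ} {C : Matrix (Fin l) (Fin n) ℝ}
    {A : Matrix (Fin n) (Fin n) ℝ} (h : Observable C A) : GeometricallyObservable C A := by
  intro V hV hC
  have hpow : ∀ k : ℕ, ∀ v ∈ V, A ^ k *ᵥ v ∈ V := by
    intro k
    induction k with
    | zero => exact fun v hv => by rwa [pow_zero, one_mulVec]
    | succ k ih =>
      intro v hv
      rw [pow_succ', ← mulVec_mulVec]
      exact hV _ (ih v hv)
  refine (Submodule.eq_bot_iff V).2 fun v hv => ?_
  refine mulVec_injective_of_rank_eq_card (h.trans (Fintype.card_fin n).symm) ?_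
  rw [mulVec_zero]
  ext q
  have := congrFun (hC _ (hpow q.1 v hv)) q.2
  rwa [mulVec_mulVec] at this

theorem psdSqrt_mulVec_eq_zero {Q : Matrix (Fin n) (Fin n) ℝ} (hQ : Q.PosSemidef) {v : Fin n → ℝ}
    (hv : Q *ᵥ v = 0) : psdSqrt Q *ᵥ v = 0 := by
  open scoped MatrixOrder in
  have hsymm : (psdSqrt Q)ᵀ = psdSqrt Q :=
    isHermitian_iff_isSymm.1 (nonneg_iff_posSemidef.1 (CFC.sqrt_nonneg Q)).1
  have hsq : psdSqrt Q * psdSqrt Q = Q :=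
    CFC.sqrt_mul_sqrt_self Q (nonneg_iff_posSemidef.2 hQ)
  refine dotProduct_self_eq_zero.1 ?_
  rw [dotProduct_comm, ← dotProduct_transpose_mulVec, hsymm, mulVec_mulVec, hsq, hv,
    dotProduct_zero]

theorem geometricallyObservable_inv {A Q : Matrix (Fin n) (Fin n) ℝ} (hA : IsUnit A.det)
    (hQ : Q.PosSemidef) (hQA : Observable (psdSqrt Q) A) : GeometricallyObservable Q A⁻¹ :=
  (hQA.geometricallyObservable.of_ker_le fun _ => psdSqrt_mulVec_eq_zero hQ).inv hA

end Observability

section Riccati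

open scoped MatrixOrder

theorem Hurwitz.le_of_lyapunov {n : ℕ} {F P₁ P₂ W₁ W₂ : Matrix (Fin n) (Fin n) ℝ} (hF : Hurwitz F)
    (h₁ : lyapunovMap F P₁ + W₁ = 0) (h₂ : lyapunovMap F P₂ + W₂ = 0) (hW : W₁ ≤ W₂) :
    P₁ ≤ P₂ := by
  rw [Matrix.le_iff] at hW ⊢
  refine hF.posSemidef_of_lyapunov hW ?_
  rw [map_sub, sub_add_sub_comm, h₁, h₂, sub_zero]

theorem polarization {ι : Type*} [Fintype ι] {P : Matrix ι ι ℝ} (hP : P.IsSymm) (v w : ι → ℝ) :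
    v ⬝ᵥ P *ᵥ w = ((v + w) ⬝ᵥ P *ᵥ (v + w) - v ⬝ᵥ P *ᵥ v - w ⬝ᵥ P *ᵥ w) / 2 := by
  simp only [mulVec_add, add_dotProduct, dotProduct_add, dotProduct_mulVec_comm hP w v]
  ring

theorem exists_tendsto_of_antitone {ι : Type*} [Finite ι] {P : ℕ → Matrix ι ι ℝ}
    (hP : ∀ i, (P i).PosSemidef) (hanti : Antitone P) :
    ∃ L : Matrix ι ι ℝ, L.PosSemidef ∧ Tendsto P atTop (𝓝 L) := by
  classical
  have := Fintype.ofFinite ι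
  have hform : ∀ v, ∃ c, Tendsto (fun i => v ⬝ᵥ P i *ᵥ v) atTop (𝓝 c) := by
    refine fun v => ⟨_, tendsto_atTop_ciInf (fun i j hij => ?_) ⟨0, ?_⟩⟩
    · have := dotProduct_mulVec_nonneg (Matrix.le_iff.1 (hanti hij)) v
      rwa [sub_mulVec, dotProduct_sub, sub_nonneg] at this
    · rintro _ ⟨i, rfl⟩
      exact dotProduct_mulVec_nonneg (hP i) v
  choose c hc using hform
  have hentry : ∀ a b, ∃ l, Tendsto (fun i => P i a b) atTop (𝓝 l) := fun a b => by
    refine ⟨_, ((((hc (Pi.single a 1 + Pi.single b 1)).sub (hc (Pi.single a 1))).sub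
      (hc (Pi.single b 1))).div_const 2).congr fun i => ?_⟩
    rw [← polarization (isHermitian_iff_isSymm.1 (hP i).1), mulVec_single_one,
      single_one_dotProduct, col_apply]
  choose L hL using hentry
  have hlim : Tendsto P atTop (𝓝 (of L)) :=
    tendsto_pi_nhds.2 fun a => tendsto_pi_nhds.2 fun b => hL a b
  exact ⟨of L, isClosed_posSemidef.mem_of_tendsto hlim (Eventually.of_forall hP), hlim⟩

variable {n m : ℕ}

/-- The inverse closed-loop matrix `F = A⁻¹ (I + B K)` of the policy-iteration equations. -/
noncomputable def closedLoop (A : Matrix (Fin n) (Fin n) ℝ) (B : Matrix (Fin n) (Fin m) ℝ)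
    (K : Matrix (Fin m) (Fin n) ℝ) : Matrix (Fin n) (Fin n) ℝ :=
  A⁻¹ * (1 + B * K)

/-- The weight `Q + Kᵀ R K` of the quadratic cost `∫ ẋᵀ (Q + Kᵀ R K) ẋ` incurred by `u = -K ẋ`. -/
def stageCost (Q : Matrix (Fin n) (Fin n) ℝ) (R : Matrix (Fin m) (Fin m) ℝ)
    (K : Matrix (Fin m) (Fin n) ℝ) : Matrix (Fin n) (Fin n) ℝ :=
  Q + Kᵀ * R * K

variable {A : Matrix (Fin n) (Fin n) ℝ} {B : Matrix (Fin n) (Fin m) ℝ}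
  {Q : Matrix (Fin n) (Fin n) ℝ} {R : Matrix (Fin m) (Fin m) ℝ}
  {K : Matrix (Fin m) (Fin n) ℝ} {P P' : Matrix (Fin n) (Fin n) ℝ}

theorem posSemidef_stageCost (hQ : Q.PosSemidef) (hR : R.PosSemidef)
    (K : Matrix (Fin m) (Fin n) ℝ) : (stageCost Q R K).PosSemidef :=
  hQ.add (posSemidef_transpose_mul_mul hR K)

theorem solvesEvaluation_iff :
    SolvesEvaluation A B Q R K P ↔ lyapunovMap (closedLoop A B K) P + stageCost Q R K = 0 := by
  rw [SolvesEvaluation, lyapunovMap_apply, closedLoop, stageCost, ← add_assoc]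

theorem stabilizing_iff (hA : IsUnit A.det) :
    Stabilizing A B K ↔ Hurwitz (closedLoop A B K) := by
  constructor
  · rintro ⟨hdet, h⟩
    simpa only [closedLoop, Matrix.mul_inv_rev, nonsing_inv_nonsing_inv _ hdet] using h.inv
  · intro h
    have hdet := (isUnit_iff_isUnit_det _).1 h.isUnit
    rw [closedLoop, det_mul] at hdet
    refine ⟨isUnit_of_mul_isUnit_right hdet, ?_⟩
    simpa only [closedLoop, Matrix.mul_inv_rev, nonsing_inv_nonsing_inv _ hA] using h.inv

theorem mul_gainOf (hR : IsUnit R.det) (P : Matrix (Fin n) (Fin n) ℝ) :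
    R * gainOf A B R P = -(Bᵀ * A⁻¹ᵀ * P) := by
  rw [gainOf, Matrix.mul_neg, Matrix.mul_assoc R⁻¹, Matrix.mul_assoc R⁻¹,
    mul_nonsing_inv_cancel_left _ _ hR]

theorem lyapunovMap_closedLoop_add_stageCost (hRs : R.IsSymm) (hR : IsUnit R.det) (hP : P.IsSymm)
    (K : Matrix (Fin m) (Fin n) ℝ) :
    lyapunovMap (closedLoop A B K) P + stageCost Q R K =
      (P * A⁻¹ + A⁻¹ᵀ * P - P * A⁻¹ * B * R⁻¹ * Bᵀ * A⁻¹ᵀ * P + Q) +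
        (K - gainOf A B R P)ᵀ * R * (K - gainOf A B R P) := by
  set L := gainOf A B R P with hL
  have hRL : R * L = -(Bᵀ * A⁻¹ᵀ * P) := mul_gainOf hR P
  have hLR : Lᵀ * R = -(P * A⁻¹ * B) := by
    have := congrArg transpose hRL
    simpa only [transpose_mul, transpose_neg, transpose_transpose, hRs.eq, hP.eq,
      Matrix.mul_assoc] using this
  have hquad : P * A⁻¹ * B * R⁻¹ * Bᵀ * A⁻¹ᵀ * P = Lᵀ * R * L := by
    rw [hLR, hL, gainOf]
    simp only [Matrix.mul_assoc, Matrix.neg_mul, Matrix.mul_neg, neg_neg]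
  have hPF : P * closedLoop A B K = P * A⁻¹ - Lᵀ * R * K := by
    rw [hLR, closedLoop]
    simp only [Matrix.mul_add, Matrix.mul_one, Matrix.mul_assoc, Matrix.neg_mul, sub_neg_eq_add]
  have hFP : (closedLoop A B K)ᵀ * P = A⁻¹ᵀ * P - Kᵀ * R * L := by
    rw [Matrix.mul_assoc Kᵀ, hRL, closedLoop]
    simp only [transpose_mul, transpose_add, transpose_one, Matrix.add_mul, Matrix.one_mul,
      Matrix.mul_assoc, Matrix.mul_neg, sub_neg_eq_add]
  rw [hquad, lyapunovMap_apply, hPF, hFP, stageCost, transpose_sub]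
  simp only [Matrix.sub_mul, Matrix.mul_sub]
  abel

theorem solvesARE_iff (hRs : R.IsSymm) (hR : IsUnit R.det) (hP : P.IsSymm) :
    SolvesARE A B Q R P ↔ SolvesEvaluation A B Q R (gainOf A B R P) P := by
  rw [SolvesARE, solvesEvaluation_iff, lyapunovMap_closedLoop_add_stageCost hRs hR hP, sub_self,
    Matrix.mul_zero, add_zero]

theorem SolvesEvaluation.lyapunovMap_gainOf (h : SolvesEvaluation A B Q R K P) (hRs : R.IsSymm)
    (hR : IsUnit R.det) (hP : P.IsSymm) :
    lyapunovMap (closedLoop A B (gainOf A B R P)) P + (stageCost Q R (gainOf A B R P) +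
      (K - gainOf A B R P)ᵀ * R * (K - gainOf A B R P)) = 0 := by
  rw [solvesEvaluation_iff, lyapunovMap_closedLoop_add_stageCost hRs hR hP] at h
  rw [← add_assoc, lyapunovMap_closedLoop_add_stageCost hRs hR hP, sub_self, Matrix.mul_zero,
    add_zero, h]

theorem SolvesEvaluation.posDef (h : SolvesEvaluation A B Q R K P)
    (hobs : GeometricallyObservable Q A⁻¹) (hQ : Q.PosSemidef) (hR : R.PosDef)
    (hP : P.PosSemidef) : P.PosDef := by
  have hobsK := hobs.feedback hQ hR PosSemidef.zero B K
  rw [add_zero] at hobsK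
  exact hobsK.posDef_of_lyapunov hP (posSemidef_stageCost hQ hR.posSemidef K)
    (solvesEvaluation_iff.1 h)

theorem SolvesEvaluation.posDef_of_hurwitz (h : SolvesEvaluation A B Q R K P)
    (hobs : GeometricallyObservable Q A⁻¹) (hQ : Q.PosSemidef) (hR : R.PosDef)
    (hK : Hurwitz (closedLoop A B K)) : P.PosDef :=
  h.posDef hobs hQ hR
    (hK.posSemidef_of_lyapunov (posSemidef_stageCost hQ hR.posSemidef K) (solvesEvaluation_iff.1 h))

theorem SolvesEvaluation.hurwitz_gainOf (h : SolvesEvaluation A B Q R K P)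
    (hobs : GeometricallyObservable Q A⁻¹) (hQ : Q.PosSemidef) (hR : R.PosDef) (hP : P.PosDef) :
    Hurwitz (closedLoop A B (gainOf A B R P)) := by
  have hS := posSemidef_transpose_mul_mul hR.posSemidef (K - gainOf A B R P)
  exact (hobs.feedback hQ hR hS B (gainOf A B R P)).hurwitz_of_lyapunov hP
    ((posSemidef_stageCost hQ hR.posSemidef _).add hS)
    (h.lyapunovMap_gainOf (isHermitian_iff_isSymm.1 hR.1) ((isUnit_iff_isUnit_det _).1 hR.isUnit)
      (isHermitian_iff_isSymm.1 hP.1))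

theorem SolvesEvaluation.le_of_gainOf (h : SolvesEvaluation A B Q R K P)
    (h' : SolvesEvaluation A B Q R (gainOf A B R P) P') (hR : R.PosDef) (hP : P.IsSymm)
    (hK : Hurwitz (closedLoop A B (gainOf A B R P))) : P' ≤ P :=
  hK.le_of_lyapunov (solvesEvaluation_iff.1 h')
    (h.lyapunovMap_gainOf (isHermitian_iff_isSymm.1 hR.1) ((isUnit_iff_isUnit_det _).1 hR.isUnit)
      hP)
    (le_add_of_nonneg_right
      (nonneg_iff_posSemidef.2 (posSemidef_transpose_mul_mul hR.posSemidef _)))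

theorem SolvesARE.le_of_evaluation (h' : SolvesARE A B Q R P') (h : SolvesEvaluation A B Q R K P)
    (hR : R.PosDef) (hP' : P'.IsSymm) (hK : Hurwitz (closedLoop A B K)) : P' ≤ P := by
  have hsq := lyapunovMap_closedLoop_add_stageCost (A := A) (B := B) (Q := Q)
    (isHermitian_iff_isSymm.1 hR.1) ((isUnit_iff_isUnit_det _).1 hR.isUnit) hP' K
  rw [show _ = (0 : Matrix (Fin n) (Fin n) ℝ) from h', zero_add] at hsq
  refine hK.le_of_lyapunov (W₁ := stageCost Q R K -
    (K - gainOf A B R P')ᵀ * R * (K - gainOf A B R P')) ?_ (solvesEvaluation_iff.1 h) ?_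
  · rw [← add_sub_assoc, hsq, sub_self]
  · exact sub_le_self _ (nonneg_iff_posSemidef.2 (posSemidef_transpose_mul_mul hR.posSemidef _))

theorem SolvesARE.unique (h : SolvesARE A B Q R P) (h' : SolvesARE A B Q R P')
    (hobs : GeometricallyObservable Q A⁻¹) (hQ : Q.PosSemidef) (hR : R.PosDef)
    (hP : P.PosDef) (hP' : P'.PosDef) : P = P' := by
  have hRu := (isUnit_iff_isUnit_det _).1 hR.isUnit
  have le : ∀ {P P' : Matrix (Fin n) (Fin n) ℝ}, SolvesARE A B Q R P → SolvesARE A B Q R P' →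
      P.PosDef → P'.PosDef → P ≤ P' := fun {P P'} h h' hP hP' => by
    have heval := (solvesARE_iff (isHermitian_iff_isSymm.1 hR.1) hRu
      (isHermitian_iff_isSymm.1 hP'.1)).1 h'
    exact h.le_of_evaluation heval hR (isHermitian_iff_isSymm.1 hP.1)
      (heval.hurwitz_gainOf hobs hQ hR hP')
  exact le_antisymm (le h h' hP hP') (le h' h hP' hP)

/-- Model-based policy iteration: `P i` evaluates the gain `K i`, and `K (i + 1)` is the gain
improved with `P i`. -/
structure IsPolicyIteration (A : Matrix (Fin n) (Fin n) ℝ) (B : Matrix (Fin n) (Fin m) ℝ)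
    (Q : Matrix (Fin n) (Fin n) ℝ) (R : Matrix (Fin m) (Fin m) ℝ)
    (K : ℕ → Matrix (Fin m) (Fin n) ℝ) (P : ℕ → Matrix (Fin n) (Fin n) ℝ) : Prop where
  isSymm : ∀ i, (P i).IsSymm
  evaluation : ∀ i, SolvesEvaluation A B Q R (K i) (P i)
  improvement : ∀ i, K (i + 1) = gainOf A B R (P i)

namespace IsPolicyIteration

variable {K : ℕ → Matrix (Fin m) (Fin n) ℝ} {P : ℕ → Matrix (Fin n) (Fin n) ℝ}
  {L : Matrix (Fin n) (Fin n) ℝ}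

theorem hurwitz (h : IsPolicyIteration A B Q R K P) (hobs : GeometricallyObservable Q A⁻¹)
    (hQ : Q.PosSemidef) (hR : R.PosDef) (hK₀ : Hurwitz (closedLoop A B (K 0))) (i : ℕ) :
    Hurwitz (closedLoop A B (K i)) := by
  induction i with
  | zero => exact hK₀
  | succ i ih =>
    rw [h.improvement]
    exact (h.evaluation i).hurwitz_gainOf hobs hQ hR
      ((h.evaluation i).posDef_of_hurwitz hobs hQ hR ih)

theorem antitone (h : IsPolicyIteration A B Q R K P) (hR : R.PosDef)
    (hK : ∀ i, Hurwitz (closedLoop A B (K i))) : Antitone P := by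
  refine antitone_nat_of_succ_le fun i => ?_
  have hKi := hK (i + 1)
  have heval := h.evaluation (i + 1)
  rw [h.improvement] at hKi heval
  exact (h.evaluation i).le_of_gainOf heval hR (h.isSymm i) hKi

theorem tendsto_gain (h : IsPolicyIteration A B Q R K P) (hL : Tendsto P atTop (𝓝 L)) :
    Tendsto K atTop (𝓝 (gainOf A B R L)) := by
  have hcont : Continuous (gainOf A B R) := by
    unfold gainOf
    fun_prop
  rw [← tendsto_add_atTop_iff_nat 1]
  exact ((hcont.tendsto L).comp hL).congr fun i => (h.improvement i).symm

theorem solvesEvaluation_limit (h : IsPolicyIteration A B Q R K P) (hL : Tendsto P atTop (𝓝 L)) :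
    SolvesEvaluation A B Q R (gainOf A B R L) L := by
  have hcont : Continuous fun M : Matrix (Fin n) (Fin n) ℝ × Matrix (Fin m) (Fin n) ℝ =>
      M.1 * (A⁻¹ * (1 + B * M.2)) + (A⁻¹ * (1 + B * M.2))ᵀ * M.1 + Q + M.2ᵀ * R * M.2 := by
    fun_prop
  exact tendsto_nhds_unique ((hcont.tendsto (L, _)).comp (hL.prodMk_nhds (h.tendsto_gain hL)))
    (tendsto_const_nhds.congr fun i => (h.evaluation i).symm)

theorem exists_tendsto (h : IsPolicyIteration A B Q R K P) (hobs : GeometricallyObservable Q A⁻¹)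
    (hQ : Q.PosSemidef) (hR : R.PosDef) (hK₀ : Hurwitz (closedLoop A B (K 0))) :
    ∃ L, L.PosDef ∧ SolvesARE A B Q R L ∧ Tendsto P atTop (𝓝 L) := by
  have hK := h.hurwitz hobs hQ hR hK₀
  obtain ⟨L, hL₀, hL⟩ := exists_tendsto_of_antitone
    (fun i => ((h.evaluation i).posDef_of_hurwitz hobs hQ hR (hK i)).posSemidef) (h.antitone hR hK)
  have heval := h.solvesEvaluation_limit hL
  exact ⟨L, heval.posDef hobs hQ hR hL₀, (solvesARE_iff (isHermitian_iff_isSymm.1 hR.1)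
    ((isUnit_iff_isUnit_det _).1 hR.isUnit) (isHermitian_iff_isSymm.1 hL₀.1)).2 heval, hL⟩

end IsPolicyIteration

end Riccati

section AbsolutelyContinuous

variable {ι : Type*} {a b : ℝ}

theorem absolutelyContinuousOnInterval_const (c : ℝ) :
    AbsolutelyContinuousOnInterval (fun _ => c) a b :=
  (LipschitzWith.const c).lipschitzOnWith.absolutelyContinuousOnInterval

theorem absolutelyContinuousOnInterval_sum (s : Finset ι) {f : ι → ℝ → ℝ}
    (hf : ∀ i ∈ s, AbsolutelyContinuousOnInterval (f i) a b) :
    AbsolutelyContinuousOnInterval (fun t => ∑ i ∈ s, f i t) a b := by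
  classical
  induction s using Finset.induction_on with
  | empty => simpa only [Finset.sum_empty] using absolutelyContinuousOnInterval_const 0
  | insert i s hi ih =>
    simp only [Finset.sum_insert hi]
    exact (hf i (Finset.mem_insert_self i s)).fun_add
      (ih fun j hj => hf j (Finset.mem_insert_of_mem hj))

variable [Fintype ι] {x : ℝ → ι → ℝ}

theorem absolutelyContinuousOnInterval_apply (hx : AbsolutelyContinuousOnInterval x a b) (i : ι) :
    AbsolutelyContinuousOnInterval (fun t => x t i) a b :=
  squeeze_zero (fun _ => Finset.sum_nonneg fun _ _ => dist_nonneg)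
    (fun _ => Finset.sum_le_sum fun _ _ => dist_le_pi_dist _ _ i) hx

theorem absolutelyContinuousOnInterval_quadraticForm (hx : AbsolutelyContinuousOnInterval x a b)
    (P : Matrix ι ι ℝ) : AbsolutelyContinuousOnInterval (fun t => x t ⬝ᵥ P *ᵥ x t) a b := by
  simp only [dotProduct, mulVec]
  exact absolutelyContinuousOnInterval_sum _ fun i _ =>
    (absolutelyContinuousOnInterval_apply hx i).fun_mul (absolutelyContinuousOnInterval_sum _
      fun k _ => (absolutelyContinuousOnInterval_apply hx k).const_mul (P i k))

theorem hasDerivAt_quadraticForm {y : ι → ℝ} {t : ℝ} (hx : HasDerivAt x y t) {P : Matrix ι ι ℝ}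
    (hP : P.IsSymm) : HasDerivAt (fun s => x s ⬝ᵥ P *ᵥ x s) (2 * (y ⬝ᵥ P *ᵥ x t)) t := by
  have hc : ∀ i, HasDerivAt (fun s => x s i) (y i) t := hasDerivAt_pi.1 hx
  have hprod : HasDerivAt (fun s => x s ⬝ᵥ P *ᵥ x s) (y ⬝ᵥ P *ᵥ x t + x t ⬝ᵥ P *ᵥ y) t := by
    simp only [dotProduct, mulVec]
    rw [← Finset.sum_add_distrib]
    exact HasDerivAt.fun_sum fun i _ => (hc i).mul
      (HasDerivAt.fun_sum fun k _ => (hc k).const_mul (P i k))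
  rwa [dotProduct_mulVec_comm hP (x t) y, ← two_mul] at hprod

end AbsolutelyContinuous

section BilinearIntegral

variable {ι κ : Type*} [Fintype ι] [Fintype κ]

theorem dotProduct_mulVec_eq_sum (M : Matrix κ ι ℝ) (y : κ → ℝ) (z : ι → ℝ) :
    y ⬝ᵥ M *ᵥ z = ∑ q : ι × κ, z q.1 * y q.2 * M.vec q := by
  simp only [dotProduct, mulVec, Finset.mul_sum, Fintype.sum_prod_type, vec]
  rw [Finset.sum_comm]
  exact Finset.sum_congr rfl fun i _ => Finset.sum_congr rfl fun k _ => by ring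

variable {f : ℝ → ι → ℝ} {g : ℝ → κ → ℝ} {a b : ℝ}

theorem intervalIntegrable_dotProduct_mulVec
    (h : ∀ i k, IntervalIntegrable (fun t => f t i * g t k) volume a b) (M : Matrix κ ι ℝ) :
    IntervalIntegrable (fun t => g t ⬝ᵥ M *ᵥ f t) volume a b := by
  simp only [dotProduct_mulVec_eq_sum]
  simpa only [Finset.sum_fn] using
    IntervalIntegrable.sum Finset.univ fun q _ => (h q.1 q.2).mul_const (M.vec q)

theorem integral_dotProduct_mulVec
    (h : ∀ i k, IntervalIntegrable (fun t => f t i * g t k) volume a b) (M : Matrix κ ι ℝ) :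
    ∫ t in a..b, g t ⬝ᵥ M *ᵥ f t =
      ∑ q : ι × κ, (∫ t in a..b, f t q.1 * g t q.2) * M.vec q := by
  simp only [dotProduct_mulVec_eq_sum]
  rw [intervalIntegral.integral_finsetSum fun q _ => (h q.1 q.2).mul_const (M.vec q)]
  simp only [intervalIntegral.integral_mul_const]

end BilinearIntegral

section Trajectory

variable {n m : ℕ} {A : Matrix (Fin n) (Fin n) ℝ} {B : Matrix (Fin n) (Fin m) ℝ}
  {R : Matrix (Fin m) (Fin m) ℝ} {P W : Matrix (Fin n) (Fin n) ℝ} {K : Matrix (Fin m) (Fin n) ℝ}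

theorem dotProduct_mul_gainOf_mulVec (hR : IsUnit R.det) (hP : P.IsSymm) (v : Fin m → ℝ)
    (y : Fin n → ℝ) :
    v ⬝ᵥ (R * gainOf A B R P) *ᵥ y = -(y ⬝ᵥ P *ᵥ (A⁻¹ *ᵥ (B *ᵥ v))) := by
  rw [mul_gainOf hR, neg_mulVec, dotProduct_neg, ← mulVec_mulVec, ← mulVec_mulVec,
    dotProduct_transpose_mulVec, dotProduct_comm, dotProduct_transpose_mulVec, dotProduct_comm,
    dotProduct_mulVec_comm hP]

/-- Along `y = A ξ + B v` the rate `2 yᵀ P ξ` of the value `ξᵀ P ξ` depends on `y` and `v` only: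
`ξ` is eliminated through `ξ = A⁻¹ (y - B v)`. -/
theorem value_rate_eq (hA : IsUnit A.det) (hR : IsUnit R.det) (hP : P.IsSymm)
    (h : lyapunovMap (closedLoop A B K) P + W = 0) {ξ y : Fin n → ℝ} {v : Fin m → ℝ}
    (hy : y = A *ᵥ ξ + B *ᵥ v) :
    2 * (y ⬝ᵥ P *ᵥ ξ) = 2 * (y ⬝ᵥ (Kᵀ * R * gainOf A B R P) *ᵥ y) +
      2 * (v ⬝ᵥ (R * gainOf A B R P) *ᵥ y) - y ⬝ᵥ W *ᵥ y := by
  have hξ : ξ = A⁻¹ *ᵥ y - A⁻¹ *ᵥ (B *ᵥ v) := by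
    rw [hy, mulVec_add, mulVec_mulVec, nonsing_inv_mul _ hA, one_mulVec, add_sub_cancel_right]
  have hF : closedLoop A B K *ᵥ y = A⁻¹ *ᵥ y + A⁻¹ *ᵥ (B *ᵥ (K *ᵥ y)) := by
    rw [closedLoop, ← mulVec_mulVec, add_mulVec, one_mulVec, mulVec_add, ← mulVec_mulVec]
  have hK : y ⬝ᵥ (Kᵀ * R * gainOf A B R P) *ᵥ y = (K *ᵥ y) ⬝ᵥ (R * gainOf A B R P) *ᵥ y := by
    rw [Matrix.mul_assoc, ← mulVec_mulVec, dotProduct_transpose_mulVec, dotProduct_comm]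
  have hform := congrArg (fun M => y ⬝ᵥ M *ᵥ y) h
  simp only [add_mulVec, dotProduct_add, zero_mulVec, dotProduct_zero,
    dotProduct_lyapunovMap_mulVec _ hP, hF, mulVec_add] at hform
  rw [hK, dotProduct_mul_gainOf_mulVec hR hP, dotProduct_mul_gainOf_mulVec hR hP, hξ, mulVec_sub,
    dotProduct_sub]
  linarith

variable {τ : ℝ} {x : ℝ → Fin n → ℝ} {u : ℝ → Fin m → ℝ}

namespace IsTrajectory

theorem memLp_input (hx : IsTrajectory A B τ x u) (c : Fin m) :
    MemLp (fun t => u t c) 2 (volume.restrict (Set.Icc 0 τ)) :=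
  memLp_pi_iff.1 hx.input_memLp c

theorem memLp_state (hx : IsTrajectory A B τ x u) (i : Fin n) :
    MemLp (fun t => x t i) 2 (volume.restrict (Set.Icc 0 τ)) := by
  have hc : ContinuousOn (fun t => x t i) (Set.Icc 0 τ) :=
    (absolutelyContinuousOnInterval_apply hx.absCont i).continuousOn.mono Set.Icc_subset_uIcc
  obtain ⟨C, hC⟩ := isCompact_Icc.exists_bound_of_continuousOn hc
  exact MemLp.of_bound (hc.aestronglyMeasurable measurableSet_Icc) C
    ((ae_restrict_iff' measurableSet_Icc).2 (ae_of_all _ hC))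

theorem memLp_deriv (hx : IsTrajectory A B τ x u) (i : Fin n) :
    MemLp (fun t => deriv x t i) 2 (volume.restrict (Set.Icc 0 τ)) := by
  have hrhs : MemLp (fun t => (∑ k, A i k * x t k) + ∑ k, B i k * u t k) 2
      (volume.restrict (Set.Icc 0 τ)) :=
    (memLp_finsetSum _ fun k _ => (hx.memLp_state k).const_mul (A i k)).add
      (memLp_finsetSum _ fun k _ => (hx.memLp_input k).const_mul (B i k))
  refine hrhs.ae_eq ?_
  filter_upwards [hx.hasDerivAt] with t ht
  rw [ht.deriv]
  rfl

variable {a b : ℝ}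

theorem intervalIntegrable_deriv_mul_deriv (hx : IsTrajectory A B τ x u)
    (ha : 0 ≤ a) (hab : a ≤ b) (hb : b ≤ τ) (i k : Fin n) :
    IntervalIntegrable (fun t => deriv x t i * deriv x t k) volume a b := by
  rw [intervalIntegrable_iff_integrableOn_Icc_of_le hab]
  exact IntegrableOn.mono_set (s := Set.Icc a b) (t := Set.Icc 0 τ)
    ((hx.memLp_deriv i).integrable_mul (hx.memLp_deriv k)) (Set.Icc_subset_Icc ha hb)

theorem intervalIntegrable_deriv_mul_input (hx : IsTrajectory A B τ x u)
    (ha : 0 ≤ a) (hab : a ≤ b) (hb : b ≤ τ) (i : Fin n) (c : Fin m) :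
    IntervalIntegrable (fun t => deriv x t i * u t c) volume a b := by
  rw [intervalIntegrable_iff_integrableOn_Icc_of_le hab]
  exact IntegrableOn.mono_set (s := Set.Icc a b) (t := Set.Icc 0 τ)
    ((hx.memLp_deriv i).integrable_mul (hx.memLp_input c)) (Set.Icc_subset_Icc ha hb)

theorem value_increment (hx : IsTrajectory A B τ x u) (hA : IsUnit A.det) (hR : IsUnit R.det)
    (hP : P.IsSymm) (h : lyapunovMap (closedLoop A B K) P + W = 0)
    (ha : 0 ≤ a) (hab : a ≤ b) (hb : b ≤ τ) :
    x b ⬝ᵥ P *ᵥ x b - x a ⬝ᵥ P *ᵥ x a =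
      2 * (∫ t in a..b, deriv x t ⬝ᵥ (Kᵀ * R * gainOf A B R P) *ᵥ deriv x t) +
      2 * (∫ t in a..b, u t ⬝ᵥ (R * gainOf A B R P) *ᵥ deriv x t) -
      ∫ t in a..b, deriv x t ⬝ᵥ W *ᵥ deriv x t := by
  have hac : AbsolutelyContinuousOnInterval x a b := hx.absCont.mono (by
    rw [Set.uIcc_of_le hab, Set.uIcc_of_le (ha.trans (hab.trans hb))]
    exact Set.Icc_subset_Icc ha hb)
  have hxx := intervalIntegrable_dotProduct_mulVec
    (hx.intervalIntegrable_deriv_mul_deriv ha hab hb)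
  have hxu := intervalIntegrable_dotProduct_mulVec
    (hx.intervalIntegrable_deriv_mul_input ha hab hb)
  rw [← (absolutelyContinuousOnInterval_quadraticForm hac P).integral_deriv_eq_sub,
    ← intervalIntegral.integral_const_mul, ← intervalIntegral.integral_const_mul,
    ← intervalIntegral.integral_add ((hxx _).const_mul 2) ((hxu _).const_mul 2),
    ← intervalIntegral.integral_sub (((hxx _).const_mul 2).add ((hxu _).const_mul 2)) (hxx _)]
  refine intervalIntegral.integral_congr_ae ?_
  filter_upwards [(ae_restrict_iff' measurableSet_Icc).1 hx.hasDerivAt] with t ht hmem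
  rw [Set.uIoc_of_le hab] at hmem
  have hd := ht ⟨ha.trans hmem.1.le, hmem.2.trans hb⟩
  rw [(hasDerivAt_quadraticForm hd hP).deriv, hd.deriv]
  exact value_rate_eq hA hR hP h rfl

end IsTrajectory

end Trajectory

section LeastSquares

variable {n m : ℕ} {P : Matrix (Fin n) (Fin n) ℝ}

/-- The half-vectorization of a symmetric matrix: its independent entries, indexed by unordered
pairs to match `duplication`. Symmetry is needed for the entry at `s(a, b)` to be well defined. -/
def vech (P : Matrix (Fin n) (Fin n) ℝ) (hP : P.IsSymm) : Sym2 (Fin n) → ℝ :=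
  Sym2.lift ⟨fun a b => P a b, fun a b => (hP.apply a b).symm⟩

theorem duplication_mulVec_vech (hP : P.IsSymm) : duplication n *ᵥ vech P hP = P.vec := by
  ext q
  simp only [mulVec, dotProduct, duplication, of_apply, ite_mul, one_mul, zero_mul,
    Finset.sum_ite_eq, Finset.mem_univ, if_true, vech, Sym2.lift_mk, vec]
  exact hP.apply _ _

/-- The vector of unknowns of the least-squares problem assembled from a symmetric matrix, a bias
parameter and a gain, in the block order of `Unknown`. -/
def unknownVec (P : Matrix (Fin n) (Fin n) ℝ) (hP : P.IsSymm) (ε : Fin n → ℝ)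
    (K : Matrix (Fin m) (Fin n) ℝ) : Unknown n m → ℝ :=
  Sum.elim (vech P hP) (Sum.elim ε K.vec)

namespace Data

variable (d : Data n m)

theorem dataMatrix_mulVec_unknownVec (R : Matrix (Fin m) (Fin m) ℝ)
    (K K' : Matrix (Fin m) (Fin n) ℝ) (hP : P.IsSymm) (ε : Fin n → ℝ) :
    d.dataMatrix R K *ᵥ unknownVec P hP ε K' =
      d.deltaKappa *ᵥ P.vec + (d.deltaX *ᵥ ε + (-(2 : ℝ) • (d.Ixx *ᵥ (Kᵀ * R * K').vec)
        - (2 : ℝ) • (d.Ixu *ᵥ (R * K').vec))) := by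
  rw [dataMatrix, unknownVec, fromCols_mulVec_sumElim, fromCols_mulVec_sumElim,
    ← mulVec_mulVec, duplication_mulVec_vech, sub_mulVec, smul_mulVec, smul_mulVec,
    ← mulVec_mulVec, ← mulVec_mulVec, kronecker_mulVec_vec, kronecker_mulVec_vec,
    transpose_one, Matrix.mul_one, Matrix.mul_one]

theorem deltaKappa_mulVec_vec (P : Matrix (Fin n) (Fin n) ℝ) (j : Fin d.N) :
    (d.deltaKappa *ᵥ P.vec) j =
      d.xbar ((j + 1) * d.T) ⬝ᵥ P *ᵥ d.xbar ((j + 1) * d.T)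
        - d.xbar (j * d.T) ⬝ᵥ P *ᵥ d.xbar (j * d.T) := by
  rw [dotProduct_mulVec_eq_sum, dotProduct_mulVec_eq_sum, ← Finset.sum_sub_distrib]
  simp only [mulVec, dotProduct, deltaKappa, of_apply, xkappa, sub_mul]

theorem deltaX_mulVec (ε : Fin n → ℝ) (j : Fin d.N) :
    (d.deltaX *ᵥ ε) j = d.xbar ((j + 1) * d.T) ⬝ᵥ ε - d.xbar (j * d.T) ⬝ᵥ ε :=
  sub_dotProduct _ _ ε

variable {d}

theorem leastSquares_eq {Q : Matrix (Fin n) (Fin n) ℝ} {R : Matrix (Fin m) (Fin m) ℝ}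
    {K : Matrix (Fin m) (Fin n) ℝ} (hrank : d.FullColumnRank R K) {θ : Unknown n m → ℝ}
    (hθ : d.dataMatrix R K *ᵥ θ = d.rhs Q R K) : d.leastSquares Q R K = θ := by
  have hu : IsUnit ((d.dataMatrix R K)ᵀ * d.dataMatrix R K).det := by
    rw [← isUnit_iff_isUnit_det, ← mulVec_injective_iff_isUnit]
    exact mulVec_injective_of_rank_eq_card ((rank_transpose_mul_self _).trans hrank)
  rw [leastSquares, ← hθ, mulVec_mulVec, Matrix.mul_assoc, nonsing_inv_mul _ hu, one_mulVec]

end Data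

/-- With the bias parameter `-2 P c`, a shift of the state by `c` changes the value only by a
constant, which drops out of increments. -/
theorem dotProduct_mulVec_add_bias (hP : P.IsSymm) (y c : Fin n → ℝ) :
    (y + c) ⬝ᵥ P *ᵥ (y + c) + (y + c) ⬝ᵥ (-(2 : ℝ) • (P *ᵥ c)) =
      y ⬝ᵥ P *ᵥ y - c ⬝ᵥ P *ᵥ c := by
  simp only [mulVec_add, add_dotProduct, dotProduct_add, dotProduct_smul, smul_eq_mul,
    dotProduct_mulVec_comm hP c y]
  ring

/-- The subspace of symmetric matrices, on which the Lyapunov operator acts. -/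
def symmSubmodule (ι : Type*) : Submodule ℝ (Matrix ι ι ℝ) where
  carrier := {P | P.IsSymm}
  add_mem' := fun h₁ h₂ => h₁.add h₂
  zero_mem' := isSymm_zero
  smul_mem' := fun c _ h => h.smul c

theorem exists_lyapunov_solution {ι : Type*} [Fintype ι] {F W : Matrix ι ι ℝ}
    (hF : ∀ P : Matrix ι ι ℝ, P.IsSymm → lyapunovMap F P = 0 → P = 0) (hW : W.IsSymm) :
    ∃ P : Matrix ι ι ℝ, P.IsSymm ∧ lyapunovMap F P + W = 0 := by
  have hsymm : ∀ P ∈ symmSubmodule ι, lyapunovMap F P ∈ symmSubmodule ι :=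
    fun _ hP => isSymm_lyapunovMap F hP
  have hinj : Function.Injective ((lyapunovMap F).restrict hsymm) := by
    rw [← LinearMap.ker_eq_bot, LinearMap.ker_eq_bot']
    exact fun P h => Subtype.ext (hF P P.2 (congrArg Subtype.val h))
  obtain ⟨P, hP⟩ := LinearMap.injective_iff_surjective.1 hinj ⟨-W, (symmSubmodule ι).neg_mem hW⟩
  exact ⟨P, P.2, eq_neg_iff_add_eq_zero.1 (congrArg Subtype.val hP)⟩

variable {N : ℕ} {A : Matrix (Fin n) (Fin n) ℝ} {B : Matrix (Fin n) (Fin m) ℝ}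
  {Q W : Matrix (Fin n) (Fin n) ℝ} {R : Matrix (Fin m) (Fin m) ℝ} {K : Matrix (Fin m) (Fin n) ℝ}
  {T : ℝ} {x : ℝ → Fin n → ℝ} {u : ℝ → Fin m → ℝ}

theorem deltaKappa_add_deltaX_mulVec (N : ℕ) (T : ℝ) (x : ℝ → Fin n → ℝ) (u : ℝ → Fin m → ℝ)
    (xb : Fin n → ℝ) (hP : P.IsSymm) (j : Fin (measure N T x u xb).N) :
    ((measure N T x u xb).deltaKappa *ᵥ P.vec) j +
        ((measure N T x u xb).deltaX *ᵥ (-(2 : ℝ) • (P *ᵥ xb))) j =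
      x ((j + 1) * T) ⬝ᵥ P *ᵥ x ((j + 1) * T) - x (j * T) ⬝ᵥ P *ᵥ x (j * T) := by
  have hright := dotProduct_mulVec_add_bias hP (x ((j + 1) * T)) xb
  have hleft := dotProduct_mulVec_add_bias hP (x (j * T)) xb
  rw [Data.deltaKappa_mulVec_vec, Data.deltaX_mulVec]
  simp only [measure]
  linarith

theorem window_bounds (hT : 0 ≤ T) (j : Fin N) :
    0 ≤ (j : ℝ) * T ∧ (j : ℝ) * T ≤ (j + 1) * T ∧ ((j : ℝ) + 1) * T ≤ N * T := by
  have hj : (j : ℝ) + 1 ≤ N := by exact_mod_cast j.2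
  exact ⟨by positivity, by gcongr; linarith, by gcongr⟩

namespace IsTrajectory

theorem Ixx_mulVec_vec (hx : IsTrajectory A B (N * T) x u) (hT : 0 ≤ T) (xb : Fin n → ℝ)
    (M : Matrix (Fin n) (Fin n) ℝ) (j : Fin (measure N T x u xb).N) :
    ((measure N T x u xb).Ixx *ᵥ M.vec) j =
      ∫ t in (j * T)..((j + 1) * T), deriv x t ⬝ᵥ M *ᵥ deriv x t :=
  have ⟨ha, hab, hb⟩ := window_bounds hT j
  (integral_dotProduct_mulVec (hx.intervalIntegrable_deriv_mul_deriv ha hab hb) M).symm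

theorem Ixu_mulVec_vec (hx : IsTrajectory A B (N * T) x u) (hT : 0 ≤ T) (xb : Fin n → ℝ)
    (M : Matrix (Fin m) (Fin n) ℝ) (j : Fin (measure N T x u xb).N) :
    ((measure N T x u xb).Ixu *ᵥ M.vec) j =
      ∫ t in (j * T)..((j + 1) * T), u t ⬝ᵥ M *ᵥ deriv x t :=
  have ⟨ha, hab, hb⟩ := window_bounds hT j
  (integral_dotProduct_mulVec (hx.intervalIntegrable_deriv_mul_input ha hab hb) M).symm

theorem dataMatrix_mulVec_eq (hx : IsTrajectory A B (N * T) x u) (hT : 0 ≤ T) (xb : Fin n → ℝ)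
    (hA : IsUnit A.det) (hR : IsUnit R.det) (hP : P.IsSymm)
    (h : lyapunovMap (closedLoop A B K) P + W = 0) :
    (measure N T x u xb).dataMatrix R K *ᵥ
        unknownVec P hP (-(2 : ℝ) • (P *ᵥ xb)) (gainOf A B R P) =
      -((measure N T x u xb).Ixx *ᵥ W.vec) := by
  ext j
  obtain ⟨ha, hab, hb⟩ := window_bounds hT j
  have hincrement := hx.value_increment hA hR hP h ha hab hb
  have hmeasured := deltaKappa_add_deltaX_mulVec N T x u xb hP j
  rw [Data.dataMatrix_mulVec_unknownVec]
  simp only [Pi.add_apply, Pi.sub_apply, Pi.smul_apply, Pi.neg_apply, smul_eq_mul]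
  rw [hx.Ixx_mulVec_vec hT, hx.Ixx_mulVec_vec hT, hx.Ixu_mulVec_vec hT]
  linarith

theorem leastSquares_eq_unknownVec (hx : IsTrajectory A B (N * T) x u) (hT : 0 ≤ T)
    (xb : Fin n → ℝ) (hA : IsUnit A.det) (hR : IsUnit R.det)
    (hrank : (measure N T x u xb).FullColumnRank R K) (hP : P.IsSymm)
    (h : SolvesEvaluation A B Q R K P) :
    (measure N T x u xb).leastSquares Q R K =
      unknownVec P hP (-(2 : ℝ) • (P *ᵥ xb)) (gainOf A B R P) :=
  Data.leastSquares_eq hrank (hx.dataMatrix_mulVec_eq hT xb hA hR hP (solvesEvaluation_iff.1 h))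

theorem eq_Phat (hx : IsTrajectory A B (N * T) x u) (hT : 0 ≤ T) (xb : Fin n → ℝ)
    (hA : IsUnit A.det) (hR : IsUnit R.det) (hrank : (measure N T x u xb).FullColumnRank R K)
    (hP : P.IsSymm) (h : SolvesEvaluation A B Q R K P) :
    P = (measure N T x u xb).Phat Q R K := by
  ext a b
  rw [Data.Phat, hx.leastSquares_eq_unknownVec hT xb hA hR hrank hP h]
  rfl

/-- Injectivity of the data matrix makes the Lyapunov operator of the closed loop injective, hence
onto, on symmetric matrices. -/
theorem exists_solvesEvaluation (hx : IsTrajectory A B (N * T) x u) (hT : 0 ≤ T) (xb : Fin n → ℝ)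
    (hA : IsUnit A.det) (hQ : Q.IsSymm) (hRs : R.IsSymm) (hR : IsUnit R.det)
    (hrank : (measure N T x u xb).FullColumnRank R K) :
    ∃ P : Matrix (Fin n) (Fin n) ℝ, P.IsSymm ∧ SolvesEvaluation A B Q R K P := by
  have hinj : ∀ P : Matrix (Fin n) (Fin n) ℝ, P.IsSymm →
      lyapunovMap (closedLoop A B K) P = 0 → P = 0 := by
    intro P hP h
    have hzero := hx.dataMatrix_mulVec_eq hT xb hA hR hP (W := 0) (by rw [h, add_zero])
    rw [vec_zero, mulVec_zero, neg_zero] at hzero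
    have hθ := mulVec_injective_of_rank_eq_card hrank (hzero.trans (mulVec_zero _).symm)
    ext a b
    exact congrFun hθ (Sum.inl s(a, b))
  have hcost : (stageCost Q R K).IsSymm := hQ.add (by
    rw [IsSymm, transpose_mul, transpose_mul, transpose_transpose, hRs.eq, Matrix.mul_assoc])
  obtain ⟨P, hP, h⟩ := exists_lyapunov_solution hinj hcost
  exact ⟨P, hP, solvesEvaluation_iff.2 h⟩

theorem isSymm_Phat_and_solvesEvaluation (hx : IsTrajectory A B (N * T) x u) (hT : 0 ≤ T)
    (xb : Fin n → ℝ) (hA : IsUnit A.det) (hQ : Q.IsSymm) (hRs : R.IsSymm) (hR : IsUnit R.det)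
    (hrank : (measure N T x u xb).FullColumnRank R K) :
    ((measure N T x u xb).Phat Q R K).IsSymm ∧
      SolvesEvaluation A B Q R K ((measure N T x u xb).Phat Q R K) := by
  obtain ⟨P, hP, h⟩ := hx.exists_solvesEvaluation hT xb hA hQ hRs hR hrank
  rw [← hx.eq_Phat hT xb hA hR hrank hP h]
  exact ⟨hP, h⟩

theorem Khat_eq_gainOf (hx : IsTrajectory A B (N * T) x u) (hT : 0 ≤ T)
    (xb : Fin n → ℝ) (hA : IsUnit A.det) (hQ : Q.IsSymm) (hRs : R.IsSymm) (hR : IsUnit R.det)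
    (hrank : (measure N T x u xb).FullColumnRank R K) :
    (measure N T x u xb).Khat Q R K = gainOf A B R ((measure N T x u xb).Phat Q R K) := by
  obtain ⟨hP, h⟩ := hx.isSymm_Phat_and_solvesEvaluation hT xb hA hQ hRs hR hrank
  ext c a
  rw [Data.Khat, hx.leastSquares_eq_unknownVec hT xb hA hR hrank hP h]
  rfl

theorem epsHat_eq (hx : IsTrajectory A B (N * T) x u) (hT : 0 ≤ T)
    (xb : Fin n → ℝ) (hA : IsUnit A.det) (hQ : Q.IsSymm) (hRs : R.IsSymm) (hR : IsUnit R.det)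
    (hrank : (measure N T x u xb).FullColumnRank R K) :
    (measure N T x u xb).epsHat Q R K = -(2 : ℝ) • ((measure N T x u xb).Phat Q R K *ᵥ xb) := by
  obtain ⟨hP, h⟩ := hx.isSymm_Phat_and_solvesEvaluation hT xb hA hQ hRs hR hrank
  ext a
  rw [Data.epsHat, hx.leastSquares_eq_unknownVec hT xb hA hR hrank hP h]
  rfl

theorem solvesEvaluation_gainOf_iff (hx : IsTrajectory A B (N * T) x u) (hT : 0 ≤ T)
    (xb : Fin n → ℝ) (hA : IsUnit A.det) (hQ : Q.IsSymm) (hRs : R.IsSymm) (hR : IsUnit R.det)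
    (hrank : (measure N T x u xb).FullColumnRank R K) (P : Matrix (Fin n) (Fin n) ℝ)
    (K' : Matrix (Fin m) (Fin n) ℝ) :
    P.IsSymm ∧ SolvesEvaluation A B Q R K P ∧ K' = gainOf A B R P ↔
      P = (measure N T x u xb).Phat Q R K ∧ K' = (measure N T x u xb).Khat Q R K := by
  obtain ⟨hPhat, heval⟩ := hx.isSymm_Phat_and_solvesEvaluation hT xb hA hQ hRs hR hrank
  rw [hx.Khat_eq_gainOf hT xb hA hQ hRs hR hrank]
  constructor
  · rintro ⟨hP, h, rfl⟩
    have := hx.eq_Phat hT xb hA hR hrank hP h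
    exact ⟨this, congrArg _ this⟩
  · rintro ⟨rfl, rfl⟩
    exact ⟨hPhat, heval, rfl⟩

theorem isPolicyIteration (hx : IsTrajectory A B (N * T) x u) (hT : 0 ≤ T)
    (xb : Fin n → ℝ) (hA : IsUnit A.det) (hQ : Q.IsSymm) (hRs : R.IsSymm) (hR : IsUnit R.det)
    (K₁ : Matrix (Fin m) (Fin n) ℝ)
    (hrank : ∀ i, (measure N T x u xb).FullColumnRank R
      ((measure N T x u xb).gainSeq Q R K₁ i)) :
    IsPolicyIteration A B Q R ((measure N T x u xb).gainSeq Q R K₁)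
      ((measure N T x u xb).valueSeq Q R K₁) where
  isSymm i := (hx.isSymm_Phat_and_solvesEvaluation hT xb hA hQ hRs hR (hrank i)).1
  evaluation i := (hx.isSymm_Phat_and_solvesEvaluation hT xb hA hQ hRs hR (hrank i)).2
  improvement i := hx.Khat_eq_gainOf hT xb hA hQ hRs hR (hrank i)

end IsTrajectory

end LeastSquares

end DFC

theorem theorem2_general {n m N : ℕ}
    (A : Matrix (Fin n) (Fin n) ℝ) (B : Matrix (Fin n) (Fin m) ℝ)
    (Q : Matrix (Fin n) (Fin n) ℝ) (R : Matrix (Fin m) (Fin m) ℝ)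
    (hA : IsUnit A.det) (hQ : Q.PosSemidef) (hR : R.PosDef)
    (hQA : DFC.Observable (DFC.psdSqrt Q) A) (T : ℝ) (hT : 0 < T)
    (x : ℝ → Fin n → ℝ) (u : ℝ → Fin m → ℝ) (hx : DFC.IsTrajectory A B (N * T) x u)
    (xb : Fin n → ℝ) (d : DFC.Data n m) (hd : d = DFC.measure N T x u xb) :
    (∀ K : Matrix (Fin m) (Fin n) ℝ, d.FullColumnRank R K →
      (∀ (P : Matrix (Fin n) (Fin n) ℝ) (K' : Matrix (Fin m) (Fin n) ℝ),
        (P.IsSymm ∧ DFC.SolvesEvaluation A B Q R K P ∧ K' = DFC.gainOf A B R P) ↔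
          (P = d.Phat Q R K ∧ K' = d.Khat Q R K)) ∧
      d.epsHat Q R K = -(2 : ℝ) • (d.Phat Q R K *ᵥ xb) ∧
      (DFC.Stabilizing A B K → (d.Phat Q R K).PosDef)) ∧
    (∀ K₁ : Matrix (Fin m) (Fin n) ℝ, DFC.Stabilizing A B K₁ →
      (∀ i, d.FullColumnRank R (d.gainSeq Q R K₁ i)) →
      (∀ i, DFC.Stabilizing A B (d.gainSeq Q R K₁ i)) ∧
      ∃ Pstar : Matrix (Fin n) (Fin n) ℝ,
        (Pstar.PosDef ∧ DFC.SolvesARE A B Q R Pstar) ∧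
        (∀ P : Matrix (Fin n) (Fin n) ℝ, P.PosDef → DFC.SolvesARE A B Q R P → P = Pstar) ∧
        Tendsto (d.valueSeq Q R K₁) atTop (𝓝 Pstar) ∧
        Tendsto (d.gainSeq Q R K₁) atTop (𝓝 (DFC.gainOf A B R Pstar))) := by
  subst hd
  have hQs : Q.IsSymm := isHermitian_iff_isSymm.1 hQ.1
  have hRs : R.IsSymm := isHermitian_iff_isSymm.1 hR.1
  have hRu : IsUnit R.det := (isUnit_iff_isUnit_det _).1 hR.isUnit
  have hobs := DFC.geometricallyObservable_inv hA hQ hQA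
  simp only [DFC.stabilizing_iff hA]
  refine ⟨fun K hrank => ?_, fun K₁ hK₁ hrank => ?_⟩
  · exact ⟨hx.solvesEvaluation_gainOf_iff hT.le xb hA hQs hRs hRu hrank,
      hx.epsHat_eq hT.le xb hA hQs hRs hRu hrank,
      (hx.isSymm_Phat_and_solvesEvaluation hT.le xb hA hQs hRs hRu hrank).2.posDef_of_hurwitz
        hobs hQ hR⟩
  · have hiter := hx.isPolicyIteration hT.le xb hA hQs hRs hRu K₁ hrank
    obtain ⟨L, hL, hARE, hlim⟩ := hiter.exists_tendsto hobs hQ hR hK₁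
    exact ⟨hiter.hurwitz hobs hQ hR hK₁, L, ⟨hL, hARE⟩,
      fun P hP h => h.unique hARE hobs hQ hR hP hL, hlim, hiter.tendsto_gain hlim⟩

theorem theorem2 {n m N : ℕ}
    (A : Matrix (Fin n) (Fin n) ℝ) (B : Matrix (Fin n) (Fin m) ℝ)
    (Q : Matrix (Fin n) (Fin n) ℝ) (R : Matrix (Fin m) (Fin m) ℝ)
    (hA : IsUnit A.det) (hAB : DFC.Controllable A B)
    (hQ : Q.PosSemidef) (hR : R.PosDef) (hQA : DFC.Observable (DFC.psdSqrt Q) A)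
    (T : ℝ) (hT : 0 < T)
    (x : ℝ → Fin n → ℝ) (u : ℝ → Fin m → ℝ) (hx : DFC.IsTrajectory A B (N * T) x u)
    (xb : Fin n → ℝ) (d : DFC.Data n m) (hd : d = DFC.measure N T x u xb) :
    -- One step: least squares returns exactly the solution of the model-based equations.
    (∀ K : Matrix (Fin m) (Fin n) ℝ, d.FullColumnRank R K →
      (∀ (P : Matrix (Fin n) (Fin n) ℝ) (K' : Matrix (Fin m) (Fin n) ℝ),
        (P.IsSymm ∧ DFC.SolvesEvaluation A B Q R K P ∧ K' = DFC.gainOf A B R P) ↔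
          (P = d.Phat Q R K ∧ K' = d.Khat Q R K)) ∧
      d.epsHat Q R K = -(2 : ℝ) • (d.Phat Q R K *ᵥ xb) ∧
      (DFC.Stabilizing A B K → (d.Phat Q R K).PosDef)) ∧
    -- Convergence of the data-driven iteration to the optimal value matrix and gain.
    (∀ K₁ : Matrix (Fin m) (Fin n) ℝ, DFC.Stabilizing A B K₁ →
      (∀ i, d.FullColumnRank R (d.gainSeq Q R K₁ i)) →
      (∀ i, DFC.Stabilizing A B (d.gainSeq Q R K₁ i)) ∧
      ∃ Pstar : Matrix (Fin n) (Fin n) ℝ,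
        (Pstar.PosDef ∧ DFC.SolvesARE A B Q R Pstar) ∧
        (∀ P : Matrix (Fin n) (Fin n) ℝ, P.PosDef → DFC.SolvesARE A B Q R P → P = Pstar) ∧
        Tendsto (d.valueSeq Q R K₁) atTop (𝓝 Pstar) ∧
        Tendsto (d.gainSeq Q R K₁) atTop (𝓝 (DFC.gainOf A B R Pstar))) :=
  theorem2_general A B Q R hA hQ hR hQA T hT x u hx xb d hd
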